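/- Let $\lambda_1\ge\lambda_2>0$. Let $\widetilde{E(2)}$ be $\mathbb{R}^3$ with the group law $(x,y,z)*(x',y',z')=(x+x'\cos z-y'\sin z,\;y+x'\sin z+y'\cos z,\;z+z')$ and the left-invariant Riemannian metric $$\lambda_1^2(\cos z\,dx+\sin z\,dy)^2+\lambda_2^2(-\sin z\,dx+\cos z\,dy)^2+\frac{1}{\lambda_1^2\lambda_2^2}dz^2,$$ for which $E_1=\frac1{\lambda_1}(\cos z\,\partial_x+\sin z\,\partial_y)$, $E_2=\frac1{\lambda_2}(-\sin z\,\partial_x+\cos z\,\partial_y)$, $E_3=\lambda_1\lambda_2\,\partial_z$ is a left-invariant orthonormal frame, taken as positively oriented. The Gauss map of an immersion $X:\mathbb{C}\to\widetilde{E(2)}$ with unit normal $N=\frac{X_u\times X_v}{|X_u\times X_v|}=\sum_i N_iE_i$ (where $z=u+iv$) is $\frac{N_1+iN_2}{1+N_3}\in\mathbb{C}\cup\{\infty\}$. Let $\theta_c^+=\pi$ if $c>\sqrt2\lambda_1$, $\theta_c^+=\arccos(1-c^2/\lambda_1^2)$ if $0<c\le\sqrt2\lambda_1$, and $\Omega=\{(c,\theta)\in\mathbb{R}^2: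 c>0,\ -\theta_c^+<\theta<\theta_c^+\}$. **Theorem 5.1.** Let $(c,\theta)\in\Omega$, $D=\frac{\sin\theta}{c}$, and let $\varphi,f:\mathbb{R}\to\mathbb{R}$ be solutions of $$\varphi'(u)=\sqrt{c^2+2\cos\theta\,B(u)-D^2B(u)^2},\quad \varphi(0)=0,\qquad f'(u)=D\,B(u),\quad f(0)=0,$$ where $B(u)=\lambda_1^2\cos^2\varphi(u)+\lambda_2^2\sin^2\varphi(u)$. Put $$G(u)=\int_0^u\frac{D^2B(s)-2\cos\theta}{c+\varphi'(s)}\,ds,\qquad A=f(u)+cv,\qquad x_3=-\lambda_1\lambda_2Dv+\lambda_1\lambda_2G(u),$$ $$\begin{aligned}M_1&=c\cos x_3\cosh A-\lambda_1\lambda_2D\sin x_3\sinh A,& M_2&=c\cos x_3\sinh A-\lambda_1\lambda_2D\sin x_3\cosh A,\\ M_3&=c\sin x_3\sinh A+\lambda_1\lambda_2D\cos x_3\cosh A,& M_4&=c\sin x_3\cosh A+\lambda_1\lambda_2D\cos x_3\sinh A,\end{aligned}$$ $$\begin{aligned}x_1&=-\frac{1}{(c^2+\lambda_1^2\lambda_2^2D^2)B}\Big[\tfrac1{\lambda_1}f'\cos\varphi\,M_1-\tfrac1{\lambda_1}(c-\varphi')\sin\varphi\,M_2-\tfrac1{\lambda_2}(c-\varphi')\cos\varphi\,M_3-\tfrac1{\lambda_2}f'\sin\varphi\,M_4\Big],\\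 x_2&=-\frac{1}{(c^2+\lambda_1^2\lambda_2^2D^2)B}\Big[\tfrac1{\lambda_1}f'\cos\varphi\,M_4-\tfrac1{\lambda_1}(c-\varphi')\sin\varphi\,M_3+\tfrac1{\lambda_2}(c-\varphi')\cos\varphi\,M_2+\tfrac1{\lambda_2}f'\sin\varphi\,M_1\Big],\end{aligned}$$ where $B,\varphi,f,\varphi',f'$ are evaluated at $u$. Then $X(u+iv)=(x_1,x_2,x_3)$ is a smooth conformal minimal immersion $X:\mathbb{C}\to\widetilde{E(2)}$, and its Gauss map is $g(u+iv)=e^{f(u)+cv}e^{i\varphi(u)}$. -/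

import Mathlib

open scoped ContDiff

noncomputable section

/-- The underlying manifold of the universal covering group of the group of rigid motions of the
Euclidean plane: `ℝ³` with its global coordinates `(x, y, z) = (p 0, p 1, p 2)`.  Tangent vectors
at any point are written in the coordinate frame `∂x, ∂y, ∂z`, again as elements of `ℝ³`. -/
abbrev E2Cover : Type := Fin 3 → ℝ

namespace E2Cover

/-- The group multiplication
`(x₁,y₁,z₁) * (x₂,y₂,z₂) = (x₁ + x₂ cos z₁ - y₂ sin z₁, y₁ + x₂ sin z₁ + y₂ cos z₁, z₁ + z₂)`. -/
def gmul (p q : E2Cover) : E2Cover :=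
  ![p 0 + q 0 * Real.cos (p 2) - q 1 * Real.sin (p 2),
    p 1 + q 0 * Real.sin (p 2) + q 1 * Real.cos (p 2),
    p 2 + q 2]

/-- The inverse for `gmul`. -/
def ginv (p : E2Cover) : E2Cover :=
  ![-(p 0 * Real.cos (p 2)) - p 1 * Real.sin (p 2),
    p 0 * Real.sin (p 2) - p 1 * Real.cos (p 2),
    -p 2]

/-- The group laws for `gmul`, with identity element `(0, 0, 0)` and inverse `ginv`. -/
theorem gmul_group_laws (p q r : E2Cover) :
    gmul (gmul p q) r = gmul p (gmul q r) ∧ gmul 0 p = p ∧ gmul p 0 = p ∧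
      gmul (ginv p) p = 0 ∧ gmul p (ginv p) = 0 := by
  have h := Real.sin_sq_add_cos_sq (p 2)
  refine ⟨?_, ?_, ?_, ?_, ?_⟩ <;> ext i <;> fin_cases i <;>
    simp [gmul, ginv, Real.cos_add, Real.sin_add] <;> grind

/-- The left-invariant frame `E₁, E₂, E₃` (indexed by `0, 1, 2`), with `λ₃ = 1 / (λ₁ λ₂)`:
`E₁ = λ₁⁻¹ (cos z ∂x + sin z ∂y)`, `E₂ = λ₂⁻¹ (-sin z ∂x + cos z ∂y)`, `E₃ = λ₁ λ₂ ∂z`. -/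
def frame (l₁ l₂ : ℝ) (p : E2Cover) : Fin 3 → Fin 3 → ℝ :=
  ![![Real.cos (p 2) / l₁, Real.sin (p 2) / l₁, 0],
    ![-Real.sin (p 2) / l₂, Real.cos (p 2) / l₂, 0],
    ![0, 0, l₁ * l₂]]

/-- The left-invariant Riemannian metric
`λ₁² (cos z dx + sin z dy)² + λ₂² (-sin z dx + cos z dy)² + (λ₁ λ₂)⁻² dz²`,
as a bilinear form on tangent vectors at `p`. -/
def metric (l₁ l₂ : ℝ) (p : E2Cover) (v w : Fin 3 → ℝ) : ℝ :=
  l₁ ^ 2 * (Real.cos (p 2) * v 0 + Real.sin (p 2) * v 1)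
      * (Real.cos (p 2) * w 0 + Real.sin (p 2) * w 1)
    + l₂ ^ 2 * (-Real.sin (p 2) * v 0 + Real.cos (p 2) * v 1)
      * (-Real.sin (p 2) * w 0 + Real.cos (p 2) * w 1)
    + 1 / (l₁ ^ 2 * l₂ ^ 2) * (v 2 * w 2)

/-- The frame is orthonormal for the metric. -/
theorem metric_frame {l₁ l₂ : ℝ} (h₁ : l₁ ≠ 0) (h₂ : l₂ ≠ 0) (p : E2Cover) (i j : Fin 3) :
    metric l₁ l₂ p (frame l₁ l₂ p i) (frame l₁ l₂ p j) = if i = j then 1 else 0 := by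
  have h := Real.sin_sq_add_cos_sq (p 2)
  fin_cases i <;> fin_cases j <;> simp [metric, frame] <;> field_simp <;> grind

/-- The frame is left-invariant: the differential of left translation by `p` maps `E_i` at `q`
to `E_i` at `p * q`. -/
theorem frame_left_invariant (l₁ l₂ : ℝ) (p q : E2Cover) (i : Fin 3) :
    HasLineDerivAt ℝ (gmul p) (frame l₁ l₂ (gmul p q) i) q (frame l₁ l₂ q i) := by
  rw [HasLineDerivAt, hasDerivAt_pi]
  have key : ∀ a b : ℝ, HasDerivAt (fun t : ℝ => a + t * b) b 0 := fun a b => by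
    simpa using ((hasDerivAt_id (0 : ℝ)).mul_const b).const_add a
  intro j
  refine (key (gmul p q j) (frame l₁ l₂ (gmul p q) i j)).congr_of_eventuallyEq
    (Filter.Eventually.of_forall fun t => ?_)
  fin_cases i <;> fin_cases j <;>
    simp [gmul, frame, Real.cos_add, Real.sin_add] <;> ring

/-- The partial derivative `∂_a g_{bd}` at `p` of the coefficients `g_{bd} = ⟨∂_b, ∂_d⟩`
of the metric. -/
def dMetric (l₁ l₂ : ℝ) (p : E2Cover) (a b d : Fin 3) : ℝ :=
  fderiv ℝ (fun q : E2Cover => metric l₁ l₂ q (Pi.single b 1) (Pi.single d 1)) p (Pi.single a 1)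

/-- The Christoffel symbols (of the first kind) of the Levi-Civita connection:
`⟨∇_{∂_a} ∂_b, ∂_d⟩ = (∂_a g_{bd} + ∂_b g_{ad} - ∂_d g_{ab}) / 2`. -/
def christoffel (l₁ l₂ : ℝ) (p : E2Cover) (a b d : Fin 3) : ℝ :=
  (dMetric l₁ l₂ p a b d + dMetric l₁ l₂ p b a d - dMetric l₁ l₂ p d a b) / 2

/-- The partial derivative of a map on `ℂ` in the direction `d`: `∂_u` for `d = 1` and `∂_v` for
`d = I`, where `z = u + i v`. -/
def pd (d : ℂ) (X : ℂ → E2Cover) (z : ℂ) : Fin 3 → ℝ := fderiv ℝ X z d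

/-- The coefficients of the first fundamental form of `X`: `⟨∂_d X, ∂_e X⟩`. -/
def firstForm (l₁ l₂ : ℝ) (X : ℂ → E2Cover) (d e z : ℂ) : ℝ :=
  metric l₁ l₂ (X z) (pd d X z) (pd e X z)

/-- The coordinates of the vector `∂_d X` in the orthonormal frame `E₁, E₂, E₃`. -/
def frameCoord (l₁ l₂ : ℝ) (X : ℂ → E2Cover) (d z : ℂ) : Fin 3 → ℝ :=
  fun i => metric l₁ l₂ (X z) (pd d X z) (frame l₁ l₂ (X z) i)

/-- The left-invariant Gauss map with values in the unit sphere of `ℝ³`: the coordinates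
`(N₁, N₂, N₃)`, in the frame `E₁, E₂, E₃`, of the unit normal `N = (X_u × X_v) / |X_u × X_v|`,
where `E₁, E₂, E₃` is positively oriented. -/
def normalCoord (l₁ l₂ : ℝ) (X : ℂ → E2Cover) (z : ℂ) : Fin 3 → ℝ :=
  let n : Fin 3 → ℝ :=
    crossProduct (frameCoord l₁ l₂ X 1 z) (frameCoord l₁ l₂ X Complex.I z)
  fun i => n i / √(n 0 ^ 2 + n 1 ^ 2 + n 2 ^ 2)

/-- The unit normal vector field `N = ∑ N_i E_i` along `X`, in the coordinate frame. -/
def unitNormal (l₁ l₂ : ℝ) (X : ℂ → E2Cover) (z : ℂ) : Fin 3 → ℝ :=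
  ∑ i, normalCoord l₁ l₂ X z i • frame l₁ l₂ (X z) i

/-- The Gauss map: the stereographic projection from the south pole
`(N₁ + i N₂) / (1 + N₃)` of the left-invariant Gauss map, with values in `ℂ ∪ {∞}`. -/
def gaussMap (l₁ l₂ : ℝ) (X : ℂ → E2Cover) (z : ℂ) : OnePoint ℂ :=
  let N : Fin 3 → ℝ := normalCoord l₁ l₂ X z
  open Classical in
  if N 2 = -1 then OnePoint.infty
  else (((N 0 + N 1 * Complex.I) / (1 + N 2) : ℂ) : OnePoint ℂ)

/-- The coefficients of the second fundamental form of `X`: `⟨∇_{∂_d X} ∂_e X, N⟩`, with `∇` the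
Levi-Civita connection, written out in coordinates. -/
def secondForm (l₁ l₂ : ℝ) (X : ℂ → E2Cover) (d e z : ℂ) : ℝ :=
  metric l₁ l₂ (X z) (pd d (pd e X) z) (unitNormal l₁ l₂ X z)
    + ∑ a, ∑ b, ∑ k, christoffel l₁ l₂ (X z) a b k
        * (pd d X z a * pd e X z b * unitNormal l₁ l₂ X z k)

/-- The mean curvature, half the trace of the second fundamental form with respect to the
first one. -/
def meanCurvature (l₁ l₂ : ℝ) (X : ℂ → E2Cover) (z : ℂ) : ℝ :=
  (firstForm l₁ l₂ X 1 1 z * secondForm l₁ l₂ X Complex.I Complex.I z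
      - 2 * firstForm l₁ l₂ X 1 Complex.I z * secondForm l₁ l₂ X 1 Complex.I z
      + firstForm l₁ l₂ X Complex.I Complex.I z * secondForm l₁ l₂ X 1 1 z)
    / (2 * (firstForm l₁ l₂ X 1 1 z * firstForm l₁ l₂ X Complex.I Complex.I z
      - firstForm l₁ l₂ X 1 Complex.I z ^ 2))

/-- `X : ℂ → E2Cover` is a (smooth) conformal minimal immersion for the metric `metric l₁ l₂`. -/
structure IsConformalMinimalImmersion (l₁ l₂ : ℝ) (X : ℂ → E2Cover) : Prop where
  smooth : ContDiff ℝ ∞ X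
  immersion : ∀ z, Function.Injective (fderiv ℝ X z)
  conformal_norm : ∀ z, firstForm l₁ l₂ X 1 1 z = firstForm l₁ l₂ X Complex.I Complex.I z
  conformal_angle : ∀ z, firstForm l₁ l₂ X 1 Complex.I z = 0
  minimal : ∀ z, meanCurvature l₁ l₂ X z = 0

/-- `θ_c⁺`, which is `π` if `c > √2 λ₁` and `arccos (1 - c² / λ₁²)` if `0 < c ≤ √2 λ₁`. -/
def thetaPlus (l₁ c : ℝ) : ℝ :=
  open Classical in
  if √2 * l₁ < c then Real.pi else Real.arccos (1 - c ^ 2 / l₁ ^ 2)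

/-- The parameter set `Ω` of pairs `(c, θ)`. -/
def Omega (l₁ : ℝ) : Set (ℝ × ℝ) :=
  {q | 0 < q.1 ∧ q.2 ∈ Set.Ioo (-thetaPlus l₁ q.1) (thetaPlus l₁ q.1)}

/-- The function `B(u) = λ₁² cos² φ(u) + λ₂² sin² φ(u)`. -/
def Bfun (l₁ l₂ : ℝ) (φ : ℝ → ℝ) (u : ℝ) : ℝ :=
  l₁ ^ 2 * Real.cos (φ u) ^ 2 + l₂ ^ 2 * Real.sin (φ u) ^ 2

/-- The constant `D = sin θ / c`. -/
def Dconst (c θ : ℝ) : ℝ := Real.sin θ / c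

/-- The function `G(u) = ∫₀ᵘ (D² B(s) - 2 cos θ) / (c + φ'(s)) ds`. -/
def Gfun (l₁ l₂ c θ : ℝ) (φ : ℝ → ℝ) (u : ℝ) : ℝ :=
  ∫ s in (0 : ℝ)..u,
    (Dconst c θ ^ 2 * Bfun l₁ l₂ φ s - 2 * Real.cos θ) / (c + deriv φ s)

/-- The explicit map `X = (x₁, x₂, x₃)`. -/
def annulusMap (l₁ l₂ c θ : ℝ) (φ f : ℝ → ℝ) (z : ℂ) : E2Cover :=
  let u : ℝ := z.re
  let v : ℝ := z.im
  let D : ℝ := Dconst c θ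
  let B : ℝ := Bfun l₁ l₂ φ u
  let A : ℝ := f u + c * v
  let x₃ : ℝ := -l₁ * l₂ * D * v + l₁ * l₂ * Gfun l₁ l₂ c θ φ u
  let M₁ : ℝ := c * Real.cos x₃ * Real.cosh A - l₁ * l₂ * D * Real.sin x₃ * Real.sinh A
  let M₂ : ℝ := c * Real.cos x₃ * Real.sinh A - l₁ * l₂ * D * Real.sin x₃ * Real.cosh A
  let M₃ : ℝ := c * Real.sin x₃ * Real.sinh A + l₁ * l₂ * D * Real.cos x₃ * Real.cosh A
  let M₄ : ℝ := c * Real.sin x₃ * Real.cosh A + l₁ * l₂ * D * Real.cos x₃ * Real.sinh A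
  ![-(1 / ((c ^ 2 + l₁ ^ 2 * l₂ ^ 2 * D ^ 2) * B)) *
      (1 / l₁ * deriv f u * Real.cos (φ u) * M₁
        - 1 / l₁ * (c - deriv φ u) * Real.sin (φ u) * M₂
        - 1 / l₂ * (c - deriv φ u) * Real.cos (φ u) * M₃
        - 1 / l₂ * deriv f u * Real.sin (φ u) * M₄),
    -(1 / ((c ^ 2 + l₁ ^ 2 * l₂ ^ 2 * D ^ 2) * B)) *
      (1 / l₁ * deriv f u * Real.cos (φ u) * M₄
        - 1 / l₁ * (c - deriv φ u) * Real.sin (φ u) * M₃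
        + 1 / l₂ * (c - deriv φ u) * Real.cos (φ u) * M₂
        + 1 / l₂ * deriv f u * Real.sin (φ u) * M₁),
    x₃]

end E2Cover

end

/-!
The proof reads everything off in the left-invariant orthonormal frame `E₁, E₂, E₃`.

Put `w = (c - φ') / B`. Since `φ'² = c² + 2 cos θ B - D² B²`, the integrand defining `G` equals `w`,
and the system for `φ, f, G` becomes polynomial in `w, D` and the sine and cosine of `φ`:
`φ' = c - w B`, `f' = D B`, `G' = w`, `w' = -(λ₁² - λ₂²) sin φ cos φ (D² + w²)` (`IsProfile`,
`isProfile_of_ode`). The condition `(c, θ) ∈ Ω` gives `cos θ > 1 - c² / λ₁²`, which makes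
the radicand positive for all `0 ≤ B ≤ λ₁²` (`radicand_pos`); hence the square root is smooth, `φ`
is smooth by bootstrapping, and `D² + w² > 0`, because `D = 0` forces `θ = 0` and then `φ' > c`.

With `A = f(u) + c v`, the derivatives of the map have the frame coordinates
* `X_u`: `(D sin φ cosh A + w cos φ sinh A, -D cos φ cosh A + w sin φ sinh A, w)`,
* `X_v`: `(-D cos φ sinh A + w sin φ cosh A, -D sin φ sinh A - w cos φ cosh A, -D)`

(`IsProfile.pd_one_profileMap`, `IsProfile.pd_I_profileMap`). These are orthogonal, of the same norm
`cosh A √(D² + w²)`, and have unit normal `(cos φ, sin φ, -sinh A) / cosh A`, whose stereographic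
projection is `e^A e^{iφ}`. The Levi-Civita connection is expressed in the frame in `secondForm_eq`;
for a conformal map minimality is then the vanishing of one polynomial expression in the frame
coordinates and their derivatives (`isConformalMinimalImmersion_of_frame`), which is checked in
`IsProfile.isConformalMinimalImmersion`.
-/

namespace E2Cover

/-! ### The Levi-Civita connection in the left-invariant frame -/

theorem metric_sum_frame {l₁ l₂ : ℝ} (h₁ : l₁ ≠ 0) (h₂ : l₂ ≠ 0) (p : E2Cover)
    (a b : Fin 3 → ℝ) :
    metric l₁ l₂ p (∑ i, a i • frame l₁ l₂ p i) (∑ i, b i • frame l₁ l₂ p i)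
      = a 0 * b 0 + a 1 * b 1 + a 2 * b 2 := by
  have h := Real.sin_sq_add_cos_sq (p 2)
  simp [metric, frame, Fin.sum_univ_three]
  field_simp
  grind

/-- The coefficients of the metric depend on the third coordinate only. -/
theorem hasFDerivAt_metric (l₁ l₂ : ℝ) (p : E2Cover) (v w : Fin 3 → ℝ) :
    HasFDerivAt (fun q : E2Cover => metric l₁ l₂ q v w)
      (((l₁ ^ 2 - l₂ ^ 2) *
        ((-Real.sin (p 2) * v 0 + Real.cos (p 2) * v 1)
            * (Real.cos (p 2) * w 0 + Real.sin (p 2) * w 1)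
          + (Real.cos (p 2) * v 0 + Real.sin (p 2) * v 1)
            * (-Real.sin (p 2) * w 0 + Real.cos (p 2) * w 1))) •
        (ContinuousLinearMap.proj 2 : (Fin 3 → ℝ) →L[ℝ] ℝ)) p := by
  have hp : HasFDerivAt (fun q : E2Cover => q 2)
      (ContinuousLinearMap.proj 2 : (Fin 3 → ℝ) →L[ℝ] ℝ) p := hasFDerivAt_apply 2 p
  have hs := Real.hasDerivAt_sin (p 2)
  have hc := Real.hasDerivAt_cos (p 2)
  have key := ((((hc.mul_const (v 0)).add (hs.mul_const (v 1))).const_mul (l₁ ^ 2)).mul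
      ((hc.mul_const (w 0)).add (hs.mul_const (w 1)))).add
    (((((hs.neg.mul_const (v 0)).add (hc.mul_const (v 1))).const_mul (l₂ ^ 2)).mul
      ((hs.neg.mul_const (w 0)).add (hc.mul_const (w 1)))).add_const
        (1 / (l₁ ^ 2 * l₂ ^ 2) * (v 2 * w 2)))
  refine ((key.comp_hasFDerivAt p hp).congr_fderiv ?_).congr_of_eventuallyEq
    (Filter.Eventually.of_forall fun q => ?_)
  · congr 1
    simp only [Pi.add_apply, Pi.neg_apply]
    ring
  · simp only [metric, Function.comp, Pi.add_apply, Pi.mul_apply, Pi.neg_apply]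
    ring

theorem dMetric_eq (l₁ l₂ : ℝ) (p : E2Cover) (a b d : Fin 3) :
    dMetric l₁ l₂ p a b d = if a = 2 then (l₁ ^ 2 - l₂ ^ 2) *
      (!![-2 * Real.sin (p 2) * Real.cos (p 2), Real.cos (p 2) ^ 2 - Real.sin (p 2) ^ 2, 0;
        Real.cos (p 2) ^ 2 - Real.sin (p 2) ^ 2, 2 * Real.sin (p 2) * Real.cos (p 2), 0;
        0, 0, 0] : Matrix (Fin 3) (Fin 3) ℝ) b d else 0 := by
  rw [dMetric, (hasFDerivAt_metric l₁ l₂ p _ _).fderiv]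
  fin_cases a <;> fin_cases b <;> fin_cases d <;> simp <;> grind

theorem hasDerivAt_line {X : ℂ → E2Cover} {z : ℂ} (hX : DifferentiableAt ℝ X z) (d : ℂ)
    (i : Fin 3) : HasDerivAt (fun t : ℝ => X (z + t • d) i) (pd d X z i) 0 := by
  have h := hX.hasFDerivAt.hasLineDerivAt d
  rw [HasLineDerivAt, hasDerivAt_pi] at h
  exact h i

/-- Second partial derivatives in coordinates: the frame coordinates are differentiated, and the
frame itself turns with the third coordinate of `X`. -/
theorem pd_pd_eq {l₁ l₂ : ℝ} {X : ℂ → E2Cover} {b : ℂ → Fin 3 → ℝ} (d e z : ℂ)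
    (hX : DifferentiableAt ℝ X z) (hb : DifferentiableAt ℝ b z)
    (he : ∀ z, pd e X z = ∑ i, b z i • frame l₁ l₂ (X z) i) :
    pd d (pd e X) z = ∑ i, pd d b z i • frame l₁ l₂ (X z) i
      + pd d X z 2 • ![-(b z 0 * Real.sin (X z 2) / l₁) - b z 1 * Real.cos (X z 2) / l₂,
          b z 0 * Real.cos (X z 2) / l₁ - b z 1 * Real.sin (X z 2) / l₂, 0] := by
  have hXi := fun i => hasDerivAt_line hX d i
  have hbi := fun i => hasDerivAt_line hb d i
  have hs := (hXi 2).sin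
  have hc := (hXi 2).cos
  have hE : pd e X = fun z => ∑ i, b z i • frame l₁ l₂ (X z) i := funext he
  have hX' : ∀ i, DifferentiableAt ℝ (fun z => X z i) z := fun i => differentiableAt_pi.1 hX i
  have hb' : ∀ i, DifferentiableAt ℝ (fun z => b z i) z := fun i => differentiableAt_pi.1 hb i
  have hdiff : DifferentiableAt ℝ (pd e X) z := by
    have h2 := hX' 2
    have hb0 := hb' 0
    have hb1 := hb' 1
    have hb2 := hb' 2
    rw [hE, differentiableAt_pi]
    intro j
    fin_cases j <;> simp [frame, Fin.sum_univ_three] <;> fun_prop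
  ext j
  refine (hasDerivAt_line hdiff d j).unique ?_
  rw [hE]
  have h0 := ((hbi 0).mul (hc.div_const l₁)).sub ((hbi 1).mul (hs.div_const l₂))
  have h1 := ((hbi 0).mul (hs.div_const l₁)).add ((hbi 1).mul (hc.div_const l₂))
  have h2 := (hbi 2).mul_const (l₁ * l₂)
  fin_cases j
  · refine (h0.congr_deriv ?_).congr_of_eventuallyEq (Filter.Eventually.of_forall fun t => ?_) <;>
      simp [frame, Fin.sum_univ_three] <;> ring
  · refine (h1.congr_deriv ?_).congr_of_eventuallyEq (Filter.Eventually.of_forall fun t => ?_)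
    · simp [frame, Fin.sum_univ_three]; ring
    · simp [frame, Fin.sum_univ_three]
  · refine (h2.congr_deriv ?_).congr_of_eventuallyEq (Filter.Eventually.of_forall fun t => ?_) <;>
      simp [frame, Fin.sum_univ_three]

/-- The second fundamental form through frame coordinates `a, b` of `∂_d X, ∂_e X`. The coefficients
are those of `∇_{E_i} E_j = μ_i E_i × E_j` with `μ = ((λ₂² - λ₁²)/2, (λ₁² - λ₂²)/2, (λ₁² + λ₂²)/2)`,
as `[E₂, E₃] = λ₁² E₁`, `[E₃, E₁] = λ₂² E₂` and `[E₁, E₂] = 0`. -/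
theorem secondForm_eq {l₁ l₂ : ℝ} (h₁ : l₁ ≠ 0) (h₂ : l₂ ≠ 0) {X : ℂ → E2Cover}
    {a b : ℂ → Fin 3 → ℝ} (d e z : ℂ)
    (hX : DifferentiableAt ℝ X z) (hb : DifferentiableAt ℝ b z)
    (hd : pd d X z = ∑ i, a z i • frame l₁ l₂ (X z) i)
    (he : ∀ z, pd e X z = ∑ i, b z i • frame l₁ l₂ (X z) i) :
    secondForm l₁ l₂ X d e z =
      normalCoord l₁ l₂ X z 0 * (pd d b z 0 + (l₁ ^ 2 - l₂ ^ 2) / 2 * (a z 1 * b z 2)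
        - (l₁ ^ 2 + l₂ ^ 2) / 2 * (a z 2 * b z 1))
      + normalCoord l₁ l₂ X z 1 * (pd d b z 1 + (l₁ ^ 2 + l₂ ^ 2) / 2 * (a z 2 * b z 0)
        + (l₁ ^ 2 - l₂ ^ 2) / 2 * (a z 0 * b z 2))
      + normalCoord l₁ l₂ X z 2 * (pd d b z 2
        - (l₁ ^ 2 - l₂ ^ 2) / 2 * (a z 0 * b z 1 + a z 1 * b z 0)) := by
  rw [secondForm, pd_pd_eq d e z hX hb he, hd, he z, unitNormal]
  simp only [christoffel, dMetric_eq, Fin.sum_univ_three]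
  generalize normalCoord l₁ l₂ X z = N
  generalize X z = p
  generalize pd d b z = b'
  generalize a z = a
  generalize b z = b
  have h := Real.sin_sq_add_cos_sq (p 2)
  simp [metric, frame]
  field_simp
  generalize Real.sin (p 2) = s at *
  generalize Real.cos (p 2) = k at *
  have hk : k ^ 2 = 1 - s ^ 2 := by linarith
  have hk4 : k ^ 4 = (1 - s ^ 2) ^ 2 := by rw [← hk]; ring
  ring_nf
  simp only [hk, hk4]
  ring

/-! ### Immersions given by the frame coordinates of their derivatives -/

theorem pd_one_eq {X : ℂ → E2Cover} {u v : ℝ} {X' : Fin 3 → ℝ}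
    (hX : DifferentiableAt ℝ X ⟨u, v⟩) (h : ∀ i, HasDerivAt (fun t : ℝ => X ⟨t, v⟩ i) (X' i) u) :
    pd 1 X ⟨u, v⟩ = X' := by
  have hl : HasDerivAt (fun t : ℝ => (⟨t, v⟩ : ℂ)) 1 u := by
    have := (Complex.ofRealCLM.hasDerivAt (x := u)).add_const ((v : ℂ) * Complex.I)
    refine (this.congr_deriv (by simp)).congr_of_eventuallyEq
      (Filter.Eventually.of_forall fun t => ?_)
    apply Complex.ext <;> simp
  exact (HasFDerivAt.comp_hasDerivAt u hX.hasFDerivAt hl).unique (hasDerivAt_pi.2 h)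

theorem pd_I_eq {X : ℂ → E2Cover} {u v : ℝ} {X' : Fin 3 → ℝ}
    (hX : DifferentiableAt ℝ X ⟨u, v⟩) (h : ∀ i, HasDerivAt (fun t : ℝ => X ⟨u, t⟩ i) (X' i) v) :
    pd Complex.I X ⟨u, v⟩ = X' := by
  have hl : HasDerivAt (fun t : ℝ => (⟨u, t⟩ : ℂ)) Complex.I v := by
    have := ((Complex.ofRealCLM.hasDerivAt (x := v)).mul_const Complex.I).const_add (u : ℂ)
    refine (this.congr_deriv (by simp)).congr_of_eventuallyEq
      (Filter.Eventually.of_forall fun t => ?_)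
    apply Complex.ext <;> simp
  exact (HasFDerivAt.comp_hasDerivAt v hX.hasFDerivAt hl).unique (hasDerivAt_pi.2 h)

/-- A criterion in terms of the frame coordinates `a, b` of `∂_u X, ∂_v X`. The hypothesis `hmin` is
`⟨∇_{X_u} X_u + ∇_{X_v} X_v, N⟩ = 0`, which for a conformal map is the vanishing of the mean
curvature. -/
theorem isConformalMinimalImmersion_of_frame {l₁ l₂ : ℝ} (h₁ : l₁ ≠ 0) (h₂ : l₂ ≠ 0)
    {X : ℂ → E2Cover} (hX : ContDiff ℝ ∞ X) {a b : ℂ → Fin 3 → ℝ}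
    (hda : Differentiable ℝ a) (hdb : Differentiable ℝ b)
    (ha : ∀ z, pd 1 X z = ∑ i, a z i • frame l₁ l₂ (X z) i)
    (hb : ∀ z, pd Complex.I X z = ∑ i, b z i • frame l₁ l₂ (X z) i)
    (hnorm : ∀ z, a z 0 ^ 2 + a z 1 ^ 2 + a z 2 ^ 2 = b z 0 ^ 2 + b z 1 ^ 2 + b z 2 ^ 2)
    (hangle : ∀ z, a z 0 * b z 0 + a z 1 * b z 1 + a z 2 * b z 2 = 0)
    (hne : ∀ z, b z ≠ 0)
    (hmin : ∀ z,
      normalCoord l₁ l₂ X z 0 * (pd 1 a z 0 + pd Complex.I b z 0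
        - l₂ ^ 2 * (a z 1 * a z 2 + b z 1 * b z 2))
      + normalCoord l₁ l₂ X z 1 * (pd 1 a z 1 + pd Complex.I b z 1
        + l₁ ^ 2 * (a z 0 * a z 2 + b z 0 * b z 2))
      + normalCoord l₁ l₂ X z 2 * (pd 1 a z 2 + pd Complex.I b z 2
        - (l₁ ^ 2 - l₂ ^ 2) * (a z 0 * a z 1 + b z 0 * b z 1)) = 0) :
    IsConformalMinimalImmersion l₁ l₂ X := by
  have hXd : Differentiable ℝ X := hX.differentiable (by simp)
  have hE : ∀ z, firstForm l₁ l₂ X 1 1 z = firstForm l₁ l₂ X Complex.I Complex.I z := by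
    intro z
    rw [firstForm, firstForm, ha, hb, metric_sum_frame h₁ h₂, metric_sum_frame h₁ h₂]
    linarith [hnorm z]
  have hF : ∀ z, firstForm l₁ l₂ X 1 Complex.I z = 0 := by
    intro z
    rw [firstForm, ha, hb, metric_sum_frame h₁ h₂, hangle z]
  refine ⟨hX, fun z => ?_, hE, hF, fun z => ?_⟩
  · rw [injective_iff_map_eq_zero]
    intro d hd
    have hdec : d.re • pd 1 X z + d.im • pd Complex.I X z = 0 := by
      rw [← hd, pd, pd, ← map_smul, ← map_smul, ← map_add]
      congr 1
      apply Complex.ext <;> simp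
    have hpos : 0 < b z 0 ^ 2 + b z 1 ^ 2 + b z 2 ^ 2 := by
      by_contra! hle
      refine hne z (funext fun i => ?_)
      fin_cases i <;> simp <;> nlinarith [sq_nonneg (b z 0), sq_nonneg (b z 1), sq_nonneg (b z 2)]
    -- `dX(d) = 0` has squared length `|d|² |b|²` by conformality, so `d = 0`
    have hlin : ∑ i, (d.re * a z i + d.im * b z i) • frame l₁ l₂ (X z) i = 0 := by
      rw [← hdec, ha, hb]
      simp only [Fin.sum_univ_three, smul_add, add_smul, mul_smul]
      abel
    have hsq := metric_sum_frame h₁ h₂ (X z) (fun i => d.re * a z i + d.im * b z i)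
      (fun i => d.re * a z i + d.im * b z i)
    simp only [hlin] at hsq
    have h0 : (d.re ^ 2 + d.im ^ 2) * (b z 0 ^ 2 + b z 1 ^ 2 + b z 2 ^ 2) = 0 := by
      simp [metric] at hsq
      linear_combination -hsq - d.re ^ 2 * hnorm z - 2 * d.re * d.im * hangle z
    have h1 : d.re ^ 2 + d.im ^ 2 = 0 := (mul_eq_zero.1 h0).resolve_right hpos.ne'
    apply Complex.ext <;> simp <;> nlinarith [sq_nonneg d.re, sq_nonneg d.im]
  · have h := hmin z
    have hII : secondForm l₁ l₂ X 1 1 z + secondForm l₁ l₂ X Complex.I Complex.I z = 0 := by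
      rw [secondForm_eq h₁ h₂ 1 1 z (hXd z) (hda z) (ha z) ha,
        secondForm_eq h₁ h₂ _ _ z (hXd z) (hdb z) (hb z) hb, ← h]
      ring
    rw [meanCurvature, hF, ← hE]
    rw [show firstForm l₁ l₂ X 1 1 z * secondForm l₁ l₂ X Complex.I Complex.I z
      - 2 * 0 * secondForm l₁ l₂ X 1 Complex.I z
      + firstForm l₁ l₂ X 1 1 z * secondForm l₁ l₂ X 1 1 z
      = firstForm l₁ l₂ X 1 1 z * (secondForm l₁ l₂ X 1 1 z
        + secondForm l₁ l₂ X Complex.I Complex.I z) by ring, hII]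
    simp

theorem frameCoord_eq {l₁ l₂ : ℝ} (h₁ : l₁ ≠ 0) (h₂ : l₂ ≠ 0) {X : ℂ → E2Cover} {d z : ℂ}
    {a : Fin 3 → ℝ} (ha : pd d X z = ∑ i, a i • frame l₁ l₂ (X z) i) :
    frameCoord l₁ l₂ X d z = a := by
  ext i
  have h : frame l₁ l₂ (X z) i = ∑ j, (Pi.single i 1 : Fin 3 → ℝ) j • frame l₁ l₂ (X z) j := by
    simp [Pi.single_apply]
  rw [frameCoord, ha, h, metric_sum_frame h₁ h₂]
  fin_cases i <;> simp

theorem normalCoord_eq {l₁ l₂ : ℝ} (h₁ : l₁ ≠ 0) (h₂ : l₂ ≠ 0) {X : ℂ → E2Cover} {z : ℂ}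
    {a b n : Fin 3 → ℝ} (ha : pd 1 X z = ∑ i, a i • frame l₁ l₂ (X z) i)
    (hb : pd Complex.I X z = ∑ i, b i • frame l₁ l₂ (X z) i)
    (hn : n 0 ^ 2 + n 1 ^ 2 + n 2 ^ 2 = 1) {r : ℝ} (hr : 0 < r)
    (hab : crossProduct a b = r • n) :
    normalCoord l₁ l₂ X z = n := by
  ext i
  have hs : √((r * n 0) ^ 2 + (r * n 1) ^ 2 + (r * n 2) ^ 2) = r := by
    rw [show (r * n 0) ^ 2 + (r * n 1) ^ 2 + (r * n 2) ^ 2 = r ^ 2 by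
      linear_combination r ^ 2 * hn, Real.sqrt_sq hr.le]
  simp only [normalCoord, frameCoord_eq h₁ h₂ ha, frameCoord_eq h₁ h₂ hb, hab, Pi.smul_apply,
    smul_eq_mul, hs]
  field_simp

/-! ### Positivity of the radicand on the parameter set -/

/-- The two cases in the definition of `Ω` give the same strict inequality; for `c > √2 λ₁` it
holds for every `θ`, since the left side is below `-1`. -/
theorem one_sub_lt_cos_of_mem_Omega {l₁ c θ : ℝ} (hl₁ : 0 < l₁) (h : (c, θ) ∈ Omega l₁) :
    1 - c ^ 2 / l₁ ^ 2 < Real.cos θ := by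
  obtain ⟨hc, hθ⟩ := h
  simp only [Set.mem_Ioo] at hc hθ
  rw [← abs_lt] at hθ
  rw [← Real.cos_abs θ]
  unfold thetaPlus at hθ
  split_ifs at hθ with hlc
  · have h2 : 2 * l₁ ^ 2 < c ^ 2 := by
      calc 2 * l₁ ^ 2 = (√2 * l₁) ^ 2 := by rw [mul_pow, Real.sq_sqrt (by norm_num)]
        _ < c ^ 2 := by gcongr
    have h3 : 2 < c ^ 2 / l₁ ^ 2 := by rwa [lt_div_iff₀ (by positivity)]
    linarith [Real.neg_one_le_cos |θ|]
  · have h2 : c ^ 2 ≤ 2 * l₁ ^ 2 := by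
      calc c ^ 2 ≤ (√2 * l₁) ^ 2 := by gcongr; exact not_lt.1 hlc
        _ = 2 * l₁ ^ 2 := by rw [mul_pow, Real.sq_sqrt (by norm_num)]
    have h3 : c ^ 2 / l₁ ^ 2 ≤ 2 := by rwa [div_le_iff₀ (by positivity)]
    have h4 : 0 ≤ c ^ 2 / l₁ ^ 2 := by positivity
    have := Real.strictAntiOn_cos ⟨abs_nonneg θ, hθ.le.trans (Real.arccos_le_pi _)⟩
      ⟨Real.arccos_nonneg _, Real.arccos_le_pi _⟩ hθ
    rwa [Real.cos_arccos (by linarith) (by linarith)] at this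

/-- Multiplied by `c²`, the radicand factors as `(c² + cos θ B - B) (c² + cos θ B + B)`. -/
theorem radicand_pos {l₁ c θ B : ℝ} (hl₁ : 0 < l₁) (h : (c, θ) ∈ Omega l₁) (hB : 0 ≤ B)
    (hBl : B ≤ l₁ ^ 2) : 0 < c ^ 2 + 2 * Real.cos θ * B - Dconst c θ ^ 2 * B ^ 2 := by
  have hc : 0 < c := h.1
  have h1 := one_sub_lt_cos_of_mem_Omega hl₁ h
  have h2 : (1 - Real.cos θ) * l₁ ^ 2 < c ^ 2 := by
    rw [← lt_div_iff₀ (by positivity)]; linarith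
  have h3 : 0 < c ^ 2 + Real.cos θ * B - B := by
    nlinarith [mul_le_mul_of_nonneg_left hBl (sub_nonneg.2 (Real.cos_le_one θ))]
  have h4 : 0 < c ^ 2 + Real.cos θ * B + B := by linarith
  have h5 : c ^ 2 * (c ^ 2 + 2 * Real.cos θ * B - Dconst c θ ^ 2 * B ^ 2)
      = (c ^ 2 + Real.cos θ * B - B) * (c ^ 2 + Real.cos θ * B + B) := by
    rw [Dconst]
    field_simp
    linear_combination -B ^ 2 * Real.sin_sq_add_cos_sq θ
  exact pos_of_mul_pos_right (h5 ▸ mul_pos h3 h4) (by positivity)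

theorem Bfun_pos {l₁ l₂ : ℝ} (h₁ : 0 < l₁) (h₂ : 0 < l₂) (φ : ℝ → ℝ) (u : ℝ) :
    0 < Bfun l₁ l₂ φ u := by
  have h := Real.sin_sq_add_cos_sq (φ u)
  rcases eq_or_ne (Real.sin (φ u)) 0 with h0 | h0
  · have : Real.cos (φ u) ^ 2 = 1 := by rw [h0] at h; linarith
    rw [Bfun, this]
    positivity
  · rw [Bfun]; positivity

theorem Bfun_le {l₁ l₂ : ℝ} (h₂ : 0 < l₂) (h : l₂ ≤ l₁) (φ : ℝ → ℝ) (u : ℝ) :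
    Bfun l₁ l₂ φ u ≤ l₁ ^ 2 := by
  have h1 : l₂ ^ 2 ≤ l₁ ^ 2 := by gcongr
  rw [Bfun]
  nlinarith [Real.sin_sq_add_cos_sq (φ u),
    mul_le_mul_of_nonneg_right h1 (sq_nonneg (Real.sin (φ u)))]

/-! ### The ordinary differential equations -/

/-- Solutions of an autonomous equation with smooth right-hand side are smooth. -/
theorem contDiff_of_autonomous {F φ : ℝ → ℝ} (hF : ContDiff ℝ ∞ F)
    (h : ∀ u, HasDerivAt φ (F (φ u)) u) : ContDiff ℝ ∞ φ := by
  have hd : deriv φ = F ∘ φ := funext fun u => (h u).deriv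
  rw [contDiff_infty]
  intro n
  induction n with
  | zero =>
    exact contDiff_zero.2 (Differentiable.continuous fun u => (h u).differentiableAt)
  | succ n ih =>
    push_cast
    rw [contDiff_succ_iff_deriv]
    refine ⟨fun u => (h u).differentiableAt, by simp, ?_⟩
    rw [hd]
    exact (hF.of_le (by exact_mod_cast le_top)).comp ih

/-- The system of ordinary differential equations behind the explicit map, in terms of
`w = (c - φ') / B`: its right-hand sides contain no square root and no quotient. The initial values
are left free, and `nondegenerate` makes the conformal factor positive. -/
structure IsProfile (l₁ l₂ c D : ℝ) (φ f w G : ℝ → ℝ) : Prop where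
  smooth_φ : ContDiff ℝ ∞ φ
  smooth_f : ContDiff ℝ ∞ f
  smooth_w : ContDiff ℝ ∞ w
  smooth_G : ContDiff ℝ ∞ G
  deriv_φ : ∀ u, HasDerivAt φ (c - w u * Bfun l₁ l₂ φ u) u
  deriv_f : ∀ u, HasDerivAt f (D * Bfun l₁ l₂ φ u) u
  deriv_w : ∀ u, HasDerivAt w
    (-((l₁ ^ 2 - l₂ ^ 2) * (Real.sin (φ u) * Real.cos (φ u)) * (D ^ 2 + w u ^ 2))) u
  deriv_G : ∀ u, HasDerivAt G (w u) u
  nondegenerate : ∀ u, 0 < D ^ 2 + w u ^ 2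

theorem hasDerivAt_Bfun {l₁ l₂ : ℝ} {φ : ℝ → ℝ} {φ' u : ℝ} (h : HasDerivAt φ φ' u) :
    HasDerivAt (Bfun l₁ l₂ φ)
      (-(2 * (l₁ ^ 2 - l₂ ^ 2) * (Real.sin (φ u) * Real.cos (φ u)) * φ')) u := by
  refine (((h.cos.pow 2).const_mul (l₁ ^ 2)).add ((h.sin.pow 2).const_mul (l₂ ^ 2))).congr_deriv ?_
  simp
  ring

theorem isProfile_of_ode {l₁ l₂ c θ : ℝ} {φ f : ℝ → ℝ} (hl₂ : 0 < l₂) (hl : l₂ ≤ l₁)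
    (hΩ : (c, θ) ∈ Omega l₁)
    (hφ : ∀ u : ℝ, HasDerivAt φ (√(c ^ 2 + 2 * Real.cos θ * Bfun l₁ l₂ φ u
        - Dconst c θ ^ 2 * Bfun l₁ l₂ φ u ^ 2)) u)
    (hf : ∀ u : ℝ, HasDerivAt f (Dconst c θ * Bfun l₁ l₂ φ u) u) :
    IsProfile l₁ l₂ c (Dconst c θ) φ f (fun u => (c - deriv φ u) / Bfun l₁ l₂ φ u)
      (Gfun l₁ l₂ c θ φ) := by
  have hl₁ : 0 < l₁ := hl₂.trans_le hl
  have hc : 0 < c := hΩ.1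
  have hB := Bfun_pos hl₁ hl₂ φ
  have hrad : ∀ (ψ : ℝ → ℝ) u, 0 < c ^ 2 + 2 * Real.cos θ * Bfun l₁ l₂ ψ u
        - Dconst c θ ^ 2 * Bfun l₁ l₂ ψ u ^ 2 := fun ψ u =>
    radicand_pos hl₁ hΩ (Bfun_pos hl₁ hl₂ ψ u).le (Bfun_le hl₂ hl ψ u)
  have hBsmooth : ∀ {ψ : ℝ → ℝ}, ContDiff ℝ ∞ ψ → ContDiff ℝ ∞ (Bfun l₁ l₂ ψ) := fun h => by
    unfold Bfun
    exact (contDiff_const.mul (h.cos.pow 2)).add (contDiff_const.mul (h.sin.pow 2))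
  have hφs : ContDiff ℝ ∞ φ := by
    have hi := hBsmooth contDiff_id
    refine contDiff_of_autonomous (F := fun y => √(c ^ 2 + 2 * Real.cos θ * Bfun l₁ l₂ id y
        - Dconst c θ ^ 2 * Bfun l₁ l₂ id y ^ 2)) ?_ hφ
    exact ((contDiff_const.add (contDiff_const.mul hi)).sub
      (contDiff_const.mul (hi.pow 2))).sqrt fun y => (hrad id y).ne'
  have hφ's : ContDiff ℝ ∞ (deriv φ) := (contDiff_infty_iff_deriv.1 hφs).2
  have hBs := hBsmooth hφs
  have hp : ∀ u, 0 < deriv φ u := fun u => by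
    rw [(hφ u).deriv]; exact Real.sqrt_pos.2 (hrad φ u)
  have hp2 : ∀ u, deriv φ u ^ 2 = c ^ 2 + 2 * Real.cos θ * Bfun l₁ l₂ φ u
        - Dconst c θ ^ 2 * Bfun l₁ l₂ φ u ^ 2 := fun u => by
    rw [(hφ u).deriv, Real.sq_sqrt (hrad φ u).le]
  set w : ℝ → ℝ := fun u => (c - deriv φ u) / Bfun l₁ l₂ φ u with hw
  have hws : ContDiff ℝ ∞ w := (contDiff_const.sub hφ's).div hBs fun u => (hB u).ne'
  have hwB : ∀ u, w u * Bfun l₁ l₂ φ u = c - deriv φ u := fun u => div_mul_cancel₀ _ (hB u).ne'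
  have hG : ∀ u, HasDerivAt (Gfun l₁ l₂ c θ φ) (w u) u := by
    -- `(c + φ') (c - φ') = B (D² B - 2 cos θ)` turns the integrand into `w`
    have : Gfun l₁ l₂ c θ φ = fun u => ∫ s in (0 : ℝ)..u, w s := by
      ext u
      unfold Gfun
      congr 1
      ext s
      have h1 := hp s
      rw [hw, div_eq_div_iff (by positivity) (hB s).ne']
      linear_combination hp2 s
    intro u
    rw [this]
    exact intervalIntegral.integral_hasDerivAt_right (hws.continuous.intervalIntegrable _ _)
      hws.continuous.stronglyMeasurable.stronglyMeasurableAtFilter hws.continuous.continuousAt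
  refine ⟨hφs, ?_, hws, ?_, fun u => ?_, hf, fun u => ?_, hG, fun u => ?_⟩
  · rw [contDiff_infty_iff_deriv]
    refine ⟨fun u => (hf u).differentiableAt, ?_⟩
    rw [show deriv f = fun u => Dconst c θ * Bfun l₁ l₂ φ u from funext fun u => (hf u).deriv]
    exact contDiff_const.mul hBs
  · rw [contDiff_infty_iff_deriv]
    refine ⟨fun u => (hG u).differentiableAt, ?_⟩
    rwa [show deriv (Gfun l₁ l₂ c θ φ) = w from funext fun u => (hG u).deriv]
  · exact ((hφ u).differentiableAt.hasDerivAt).congr_deriv (by rw [hwB]; ring)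
  · have hB' := hasDerivAt_Bfun (l₁ := l₁) (l₂ := l₂) (hφ u).differentiableAt.hasDerivAt
    have hφ'd : HasDerivAt (deriv φ) (deriv (deriv φ) u) u :=
      (hφ's.differentiable (by simp) u).hasDerivAt
    -- differentiating the relation `φ'² = c² + 2 cos θ B - D² B²` gives `φ''` after
    -- division by `2 φ'`
    have hφ'' : deriv (deriv φ) u = -(2 * (l₁ ^ 2 - l₂ ^ 2) * (Real.sin (φ u) * Real.cos (φ u))
        * (Real.cos θ - Dconst c θ ^ 2 * Bfun l₁ l₂ φ u)) := by
      have hL := hφ'd.pow 2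
      have hR := ((hB'.const_mul (2 * Real.cos θ)).const_add (c ^ 2)).sub
        ((hB'.pow 2).const_mul (Dconst c θ ^ 2))
      have := (hL.congr_of_eventuallyEq (Filter.Eventually.of_forall fun t =>
        (hp2 t).symm)).unique hR
      simp at this
      have hne : 2 * deriv φ u ≠ 0 := by have := hp u; positivity
      apply mul_left_cancel₀ hne
      linear_combination this
    refine ((hφ'd.const_sub c).div hB' (hB u).ne').congr_deriv ?_
    rw [hφ'', div_eq_iff (by have := hB u; positivity)]
    have e1 := hwB u
    have e2 := hp2 u
    have hBu := (hB u).ne'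
    have hp' : deriv φ u = c - w u * Bfun l₁ l₂ φ u := by linarith
    rw [hp'] at e2 ⊢
    generalize Bfun l₁ l₂ φ u = B at *
    have e3 : w u * (2 * c - w u * B) = Dconst c θ ^ 2 * B - 2 * Real.cos θ := by
      apply mul_left_cancel₀ hBu
      linear_combination -e2
    linear_combination ((l₁ ^ 2 - l₂ ^ 2) * (Real.sin (φ u) * Real.cos (φ u)) * B) * e3
  · rcases eq_or_ne (Dconst c θ) 0 with h0 | h0
    · -- here `θ = 0`, hence `φ' > c`
      have hs : Real.sin θ = 0 := by simpa [Dconst, hc.ne'] using h0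
      have hθ : |θ| < Real.pi := by
        refine (abs_lt.2 hΩ.2).trans_le ?_
        simp only [thetaPlus]
        split_ifs
        · exact le_rfl
        · exact Real.arccos_le_pi _
      have hθ0 : θ = 0 := by
        rw [abs_lt] at hθ
        exact (Real.sin_eq_zero_iff_of_lt_of_lt hθ.1 hθ.2).1 hs
      have h2 := hp2 u
      rw [h0, hθ0, Real.cos_zero] at h2
      have hwne : w u ≠ 0 := by
        intro hw0
        have := hwB u
        rw [hw0, zero_mul] at this
        have hpc : deriv φ u = c := by linarith
        rw [hpc] at h2
        linarith [hB u]
      positivity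
    · positivity

/-! ### The explicit map and its frame coordinates -/

/-- `M₁` of the explicit map, with `d = λ₁ λ₂ D`. The four combinations `mixCC`, `mixCS`, `mixSS`,
`mixSC` are permuted up to sign by `∂/∂x` and `∂/∂A`; the letters name the leading term, `C` or `S`
for `cos x` or `sin x` and then for `cosh A` or `sinh A`. -/
noncomputable def mixCC (c d x A : ℝ) : ℝ :=
  c * Real.cos x * Real.cosh A - d * Real.sin x * Real.sinh A

/-- `M₂` of the explicit map. -/
noncomputable def mixCS (c d x A : ℝ) : ℝ :=
  c * Real.cos x * Real.sinh A - d * Real.sin x * Real.cosh A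

/-- `M₃` of the explicit map. -/
noncomputable def mixSS (c d x A : ℝ) : ℝ :=
  c * Real.sin x * Real.sinh A + d * Real.cos x * Real.cosh A

/-- `M₄` of the explicit map. -/
noncomputable def mixSC (c d x A : ℝ) : ℝ :=
  c * Real.sin x * Real.cosh A + d * Real.cos x * Real.sinh A

section mix
variable {c d x' A' t : ℝ} {x A : ℝ → ℝ}

theorem hasDerivAt_mixCC (hx : HasDerivAt x x' t) (hA : HasDerivAt A A' t) :
    HasDerivAt (fun t => mixCC c d (x t) (A t))
      (A' * mixCS c d (x t) (A t) - x' * mixSC c d (x t) (A t)) t := by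
  refine (((hx.cos.const_mul c).mul hA.cosh).sub
    ((hx.sin.const_mul d).mul hA.sinh)).congr_deriv ?_
  rw [mixCS, mixSC]; ring

theorem hasDerivAt_mixCS (hx : HasDerivAt x x' t) (hA : HasDerivAt A A' t) :
    HasDerivAt (fun t => mixCS c d (x t) (A t))
      (A' * mixCC c d (x t) (A t) - x' * mixSS c d (x t) (A t)) t := by
  refine (((hx.cos.const_mul c).mul hA.sinh).sub
    ((hx.sin.const_mul d).mul hA.cosh)).congr_deriv ?_
  rw [mixCC, mixSS]; ring

theorem hasDerivAt_mixSS (hx : HasDerivAt x x' t) (hA : HasDerivAt A A' t) :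
    HasDerivAt (fun t => mixSS c d (x t) (A t))
      (A' * mixSC c d (x t) (A t) + x' * mixCS c d (x t) (A t)) t := by
  refine (((hx.sin.const_mul c).mul hA.sinh).add
    ((hx.cos.const_mul d).mul hA.cosh)).congr_deriv ?_
  rw [mixSC, mixCS]; ring

theorem hasDerivAt_mixSC (hx : HasDerivAt x x' t) (hA : HasDerivAt A A' t) :
    HasDerivAt (fun t => mixSC c d (x t) (A t))
      (A' * mixSS c d (x t) (A t) + x' * mixCC c d (x t) (A t)) t := by
  refine (((hx.sin.const_mul c).mul hA.cosh).add
    ((hx.cos.const_mul d).mul hA.sinh)).congr_deriv ?_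
  rw [mixSS, mixCC]; ring

end mix

/-- The function `A = f(u) + c v`, the logarithm of the modulus of the Gauss map. -/
noncomputable def profileAngle (c : ℝ) (f : ℝ → ℝ) (z : ℂ) : ℝ := f z.re + c * z.im

/-- The third coordinate `x₃` of the map. -/
noncomputable def profileHeight (l₁ l₂ D : ℝ) (G : ℝ → ℝ) (z : ℂ) : ℝ :=
  l₁ * l₂ * (G z.re - D * z.im)

/-- The explicit map, with `f' / B` and `(c - φ') / B` replaced by `D` and `w`. -/
noncomputable def profileMap (l₁ l₂ c D : ℝ) (φ f w G : ℝ → ℝ) (z : ℂ) : E2Cover :=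
  let x : ℝ := profileHeight l₁ l₂ D G z
  let A : ℝ := profileAngle c f z
  let S : ℝ := Real.sin (φ z.re)
  let C : ℝ := Real.cos (φ z.re)
  let d : ℝ := l₁ * l₂ * D
  ![-(c ^ 2 + d ^ 2)⁻¹ * (D * C / l₁ * mixCC c d x A - w z.re * S / l₁ * mixCS c d x A
      - w z.re * C / l₂ * mixSS c d x A - D * S / l₂ * mixSC c d x A),
    -(c ^ 2 + d ^ 2)⁻¹ * (D * C / l₁ * mixSC c d x A - w z.re * S / l₁ * mixSS c d x A
      + w z.re * C / l₂ * mixCS c d x A + D * S / l₂ * mixCC c d x A),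
    x]

/-- The frame coordinates of `∂_u X`. -/
noncomputable def profileU (c D : ℝ) (φ f w : ℝ → ℝ) (z : ℂ) : Fin 3 → ℝ :=
  let A : ℝ := profileAngle c f z
  ![D * Real.sin (φ z.re) * Real.cosh A + w z.re * Real.cos (φ z.re) * Real.sinh A,
    -(D * Real.cos (φ z.re) * Real.cosh A) + w z.re * Real.sin (φ z.re) * Real.sinh A,
    w z.re]

/-- The frame coordinates of `∂_v X`. -/
noncomputable def profileV (c D : ℝ) (φ f w : ℝ → ℝ) (z : ℂ) : Fin 3 → ℝ :=
  let A : ℝ := profileAngle c f z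
  ![-(D * Real.cos (φ z.re) * Real.sinh A) + w z.re * Real.sin (φ z.re) * Real.cosh A,
    -(D * Real.sin (φ z.re) * Real.sinh A) - w z.re * Real.cos (φ z.re) * Real.cosh A,
    -D]

/-- The frame coordinates of the unit normal. -/
noncomputable def profileNormal (c : ℝ) (φ f : ℝ → ℝ) (z : ℂ) : Fin 3 → ℝ :=
  let A : ℝ := profileAngle c f z
  ![Real.cos (φ z.re) / Real.cosh A, Real.sin (φ z.re) / Real.cosh A,
    -(Real.sinh A / Real.cosh A)]

namespace IsProfile

variable {l₁ l₂ c D : ℝ} {φ f w G : ℝ → ℝ}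

theorem contDiff_profileAngle (h : IsProfile l₁ l₂ c D φ f w G) :
    ContDiff ℝ ∞ (profileAngle c f) :=
  (h.smooth_f.comp Complex.reCLM.contDiff).add (contDiff_const.mul Complex.imCLM.contDiff)

theorem contDiff_profileHeight (h : IsProfile l₁ l₂ c D φ f w G) :
    ContDiff ℝ ∞ (profileHeight l₁ l₂ D G) :=
  contDiff_const.mul ((h.smooth_G.comp Complex.reCLM.contDiff).sub
    (contDiff_const.mul Complex.imCLM.contDiff))

theorem contDiff_profileMap (h : IsProfile l₁ l₂ c D φ f w G) :
    ContDiff ℝ ∞ (profileMap l₁ l₂ c D φ f w G) := by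
  have hre : ContDiff ℝ ∞ Complex.re := Complex.reCLM.contDiff
  have hφ := h.smooth_φ
  have hw := h.smooth_w
  have hA := h.contDiff_profileAngle
  have hx := h.contDiff_profileHeight
  rw [contDiff_pi]
  intro i
  fin_cases i
  · simp [profileMap, mixCC, mixCS, mixSS, mixSC]
    fun_prop
  · simp [profileMap, mixCC, mixCS, mixSS, mixSC]
    fun_prop
  · exact hx

theorem differentiable_profileU (h : IsProfile l₁ l₂ c D φ f w G) :
    Differentiable ℝ (profileU c D φ f w) := by
  have hre : ContDiff ℝ ∞ Complex.re := Complex.reCLM.contDiff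
  have hφ := h.smooth_φ
  have hw := h.smooth_w
  have hA := h.contDiff_profileAngle
  refine ContDiff.differentiable (n := ∞) (contDiff_pi.2 fun i => ?_) (by simp)
  fin_cases i <;> simp [profileU] <;> fun_prop

theorem differentiable_profileV (h : IsProfile l₁ l₂ c D φ f w G) :
    Differentiable ℝ (profileV c D φ f w) := by
  have hre : ContDiff ℝ ∞ Complex.re := Complex.reCLM.contDiff
  have hφ := h.smooth_φ
  have hw := h.smooth_w
  have hA := h.contDiff_profileAngle
  refine ContDiff.differentiable (n := ∞) (contDiff_pi.2 fun i => ?_) (by simp)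
  fin_cases i <;> simp [profileV] <;> fun_prop

theorem hasDerivAt_angle_u (h : IsProfile l₁ l₂ c D φ f w G) (u v : ℝ) :
    HasDerivAt (fun t : ℝ => profileAngle c f ⟨t, v⟩) (D * Bfun l₁ l₂ φ u) u :=
  (h.deriv_f u).add_const (c * v)

theorem hasDerivAt_angle_v (u v : ℝ) :
    HasDerivAt (fun t : ℝ => profileAngle c f ⟨u, t⟩) c v :=
  (((hasDerivAt_id v).const_mul c).const_add (f u)).congr_deriv (mul_one c)

theorem hasDerivAt_height_u (h : IsProfile l₁ l₂ c D φ f w G) (u v : ℝ) :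
    HasDerivAt (fun t : ℝ => profileHeight l₁ l₂ D G ⟨t, v⟩) (l₁ * l₂ * w u) u :=
  ((h.deriv_G u).sub_const (D * v)).const_mul (l₁ * l₂)

theorem hasDerivAt_height_v (u v : ℝ) :
    HasDerivAt (fun t : ℝ => profileHeight l₁ l₂ D G ⟨u, t⟩) (-(l₁ * l₂ * D)) v :=
  ((((hasDerivAt_id v).const_mul D).const_sub (G u)).const_mul (l₁ * l₂)).congr_deriv (by ring)

/-- After inserting the derivatives of `φ, f, w, G`, both sides are linear in the
combinations `mixCC, …, mixSC`, and agree by `sin² φ + cos² φ = 1`. -/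
theorem pd_one_profileMap (h : IsProfile l₁ l₂ c D φ f w G) (h₁ : l₁ ≠ 0) (h₂ : l₂ ≠ 0)
    (hc : c ≠ 0) (z : ℂ) :
    pd 1 (profileMap l₁ l₂ c D φ f w G) z
      = ∑ i, profileU c D φ f w z i • frame l₁ l₂ (profileMap l₁ l₂ c D φ f w G z) i := by
  obtain ⟨u, v⟩ := z
  apply pd_one_eq (h.contDiff_profileMap.differentiable (by simp) _)
  have hA := h.hasDerivAt_angle_u u v
  have hx := h.hasDerivAt_height_u u v
  have hS := (h.deriv_φ u).sin
  have hC := (h.deriv_φ u).cos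
  have hw := h.deriv_w u
  have h1 := hasDerivAt_mixCC (c := c) (d := l₁ * l₂ * D) hx hA
  have h2 := hasDerivAt_mixCS (c := c) (d := l₁ * l₂ * D) hx hA
  have h3 := hasDerivAt_mixSS (c := c) (d := l₁ * l₂ * D) hx hA
  have h4 := hasDerivAt_mixSC (c := c) (d := l₁ * l₂ * D) hx hA
  have hR : c ^ 2 + (l₁ * l₂ * D) ^ 2 ≠ 0 := by positivity
  have hSC := Real.sin_sq_add_cos_sq (φ u)
  intro i
  fin_cases i
  · refine ((((((hC.const_mul D).div_const l₁).mul h1).sub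
      (((hw.mul hS).div_const l₁).mul h2)).sub (((hw.mul hC).div_const l₂).mul h3)).sub
      (((hS.const_mul D).div_const l₂).mul h4)).const_mul (-(c ^ 2 + (l₁ * l₂ * D) ^ 2)⁻¹)
      |>.congr_deriv ?_
    simp [frame, Fin.sum_univ_three, profileU, profileMap, mixCC, mixCS, mixSS, mixSC, Bfun]
    field_simp
    generalize Real.sin (φ u) = S at *
    generalize Real.cos (φ u) = C at *
    have hC2 : C ^ 2 = 1 - S ^ 2 := by linarith
    have hC3 : C ^ 3 = C * (1 - S ^ 2) := by rw [← hC2]; ring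
    ring_nf
    simp only [hC2, hC3]
    ring
  · refine ((((((hC.const_mul D).div_const l₁).mul h4).sub
      (((hw.mul hS).div_const l₁).mul h3)).add (((hw.mul hC).div_const l₂).mul h2)).add
      (((hS.const_mul D).div_const l₂).mul h1)).const_mul (-(c ^ 2 + (l₁ * l₂ * D) ^ 2)⁻¹)
      |>.congr_deriv ?_
    simp [frame, Fin.sum_univ_three, profileU, profileMap, mixCC, mixCS, mixSS, mixSC, Bfun]
    field_simp
    generalize Real.sin (φ u) = S at *
    generalize Real.cos (φ u) = C at *
    have hC2 : C ^ 2 = 1 - S ^ 2 := by linarith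
    have hC3 : C ^ 3 = C * (1 - S ^ 2) := by rw [← hC2]; ring
    ring_nf
    simp only [hC2, hC3]
    ring
  · refine hx.congr_deriv ?_
    simp [frame, profileU, Fin.sum_univ_three]
    ring

/-- Along `v` the combinations `mixCC, …, mixSC` differentiate to `c² + λ₁² λ₂² D²` times products
such as `cos x₃ sinh A`, which cancels the prefactor of the map. -/
theorem pd_I_profileMap (h : IsProfile l₁ l₂ c D φ f w G) (h₁ : l₁ ≠ 0) (h₂ : l₂ ≠ 0)
    (hc : c ≠ 0) (z : ℂ) :
    pd Complex.I (profileMap l₁ l₂ c D φ f w G) z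
      = ∑ i, profileV c D φ f w z i • frame l₁ l₂ (profileMap l₁ l₂ c D φ f w G z) i := by
  obtain ⟨u, v⟩ := z
  apply pd_I_eq (h.contDiff_profileMap.differentiable (by simp) _)
  have hA := hasDerivAt_angle_v (c := c) (f := f) u v
  have hx := hasDerivAt_height_v (l₁ := l₁) (l₂ := l₂) (D := D) (G := G) u v
  have h1 := hasDerivAt_mixCC (c := c) (d := l₁ * l₂ * D) hx hA
  have h2 := hasDerivAt_mixCS (c := c) (d := l₁ * l₂ * D) hx hA
  have h3 := hasDerivAt_mixSS (c := c) (d := l₁ * l₂ * D) hx hA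
  have h4 := hasDerivAt_mixSC (c := c) (d := l₁ * l₂ * D) hx hA
  have hR : c ^ 2 + (l₁ * l₂ * D) ^ 2 ≠ 0 := by positivity
  intro i
  fin_cases i
  · refine ((((h1.const_mul (D * Real.cos (φ u) / l₁)).sub
      (h2.const_mul (w u * Real.sin (φ u) / l₁))).sub
      (h3.const_mul (w u * Real.cos (φ u) / l₂))).sub
      (h4.const_mul (D * Real.sin (φ u) / l₂))).const_mul (-(c ^ 2 + (l₁ * l₂ * D) ^ 2)⁻¹)
      |>.congr_deriv ?_
    simp [frame, Fin.sum_univ_three, profileV, profileMap, mixCC, mixCS, mixSS, mixSC]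
    field_simp
    ring
  · refine ((((h4.const_mul (D * Real.cos (φ u) / l₁)).sub
      (h3.const_mul (w u * Real.sin (φ u) / l₁))).add
      (h2.const_mul (w u * Real.cos (φ u) / l₂))).add
      (h1.const_mul (D * Real.sin (φ u) / l₂))).const_mul (-(c ^ 2 + (l₁ * l₂ * D) ^ 2)⁻¹)
      |>.congr_deriv ?_
    simp [frame, Fin.sum_univ_three, profileV, profileMap, mixCC, mixCS, mixSS, mixSC]
    field_simp
    ring
  · refine hx.congr_deriv ?_
    simp [frame, profileV, Fin.sum_univ_three]
    ring

theorem pd_one_profileU (h : IsProfile l₁ l₂ c D φ f w G) (u v : ℝ) :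
    pd 1 (profileU c D φ f w) ⟨u, v⟩ =
      let A : ℝ := profileAngle c f ⟨u, v⟩
      let B : ℝ := Bfun l₁ l₂ φ u
      let S : ℝ := Real.sin (φ u)
      let C : ℝ := Real.cos (φ u)
      let φ' : ℝ := c - w u * B
      let w' : ℝ := -((l₁ ^ 2 - l₂ ^ 2) * (S * C) * (D ^ 2 + w u ^ 2))
      ![D * C * φ' * Real.cosh A + D * S * (D * B) * Real.sinh A
          + (w' * C - w u * S * φ') * Real.sinh A + w u * C * (D * B) * Real.cosh A,
        D * S * φ' * Real.cosh A - D * C * (D * B) * Real.sinh A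
          + (w' * S + w u * C * φ') * Real.sinh A + w u * S * (D * B) * Real.cosh A,
        w'] := by
  apply pd_one_eq (h.differentiable_profileU _)
  have hA := h.hasDerivAt_angle_u u v
  have hS := (h.deriv_φ u).sin
  have hC := (h.deriv_φ u).cos
  have hw := h.deriv_w u
  intro i
  fin_cases i
  · refine (((hS.const_mul D).mul hA.cosh).add ((hw.mul hC).mul hA.sinh)).congr_deriv ?_
    simp; ring
  · refine (((hC.const_mul D).mul hA.cosh).neg.add ((hw.mul hS).mul hA.sinh)).congr_deriv ?_
    simp; ring
  · exact hw

theorem pd_I_profileV (h : IsProfile l₁ l₂ c D φ f w G) (u v : ℝ) :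
    pd Complex.I (profileV c D φ f w) ⟨u, v⟩ =
      let A : ℝ := profileAngle c f ⟨u, v⟩
      let S : ℝ := Real.sin (φ u)
      let C : ℝ := Real.cos (φ u)
      ![c * (-(D * C * Real.cosh A) + w u * S * Real.sinh A),
        c * (-(D * S * Real.cosh A) - w u * C * Real.sinh A), 0] := by
  apply pd_I_eq (h.differentiable_profileV _)
  have hA := hasDerivAt_angle_v (c := c) (f := f) u v
  intro i
  fin_cases i
  · refine ((hA.sinh.const_mul (D * Real.cos (φ u))).neg.add
      (hA.cosh.const_mul (w u * Real.sin (φ u)))).congr_deriv ?_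
    simp; ring
  · refine ((hA.sinh.const_mul (D * Real.sin (φ u))).neg.sub
      (hA.cosh.const_mul (w u * Real.cos (φ u)))).congr_deriv ?_
    simp; ring
  · exact hasDerivAt_const v (-D)

theorem normalCoord_profileMap (h : IsProfile l₁ l₂ c D φ f w G) (h₁ : l₁ ≠ 0) (h₂ : l₂ ≠ 0)
    (hc : c ≠ 0) (z : ℂ) :
    normalCoord l₁ l₂ (profileMap l₁ l₂ c D φ f w G) z = profileNormal c φ f z := by
  have hch := Real.cosh_pos (profileAngle c f z)
  have hSC := Real.sin_sq_add_cos_sq (φ z.re)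
  have hcs := Real.cosh_sq (profileAngle c f z)
  refine normalCoord_eq h₁ h₂ (h.pd_one_profileMap h₁ h₂ hc z) (h.pd_I_profileMap h₁ h₂ hc z)
    ?_ (mul_pos (pow_pos hch 2) (h.nondegenerate z.re)) ?_
  · simp [profileNormal]
    field_simp
    linear_combination hSC - hcs
  · rw [cross_apply]
    have hC2 : Real.cos (φ z.re) ^ 2 = 1 - Real.sin (φ z.re) ^ 2 := by linarith
    ext i
    fin_cases i
    · simp [profileNormal, profileU, profileV]
      field_simp
      ring
    · simp [profileNormal, profileU, profileV]
      field_simp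
      ring
    · simp [profileNormal, profileU, profileV]
      field_simp
      ring_nf
      simp only [hC2]
      ring

theorem isConformalMinimalImmersion (h : IsProfile l₁ l₂ c D φ f w G) (h₁ : l₁ ≠ 0)
    (h₂ : l₂ ≠ 0) (hc : c ≠ 0) :
    IsConformalMinimalImmersion l₁ l₂ (profileMap l₁ l₂ c D φ f w G) := by
  refine isConformalMinimalImmersion_of_frame h₁ h₂ h.contDiff_profileMap
    h.differentiable_profileU h.differentiable_profileV
    (h.pd_one_profileMap h₁ h₂ hc) (h.pd_I_profileMap h₁ h₂ hc) ?_ ?_ ?_ ?_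
  · intro z
    have hSC := Real.sin_sq_add_cos_sq (φ z.re)
    have hcs := Real.cosh_sq (profileAngle c f z)
    simp [profileU, profileV]
    linear_combination (D ^ 2 - w z.re ^ 2) * hcs + (D ^ 2 - w z.re ^ 2) *
      (Real.cosh (profileAngle c f z) ^ 2 - Real.sinh (profileAngle c f z) ^ 2) * hSC
  · intro z
    have hSC := Real.sin_sq_add_cos_sq (φ z.re)
    have hcs := Real.cosh_sq (profileAngle c f z)
    simp [profileU, profileV]
    linear_combination D * w z.re * hcs + D * w z.re *
      (Real.cosh (profileAngle c f z) ^ 2 - Real.sinh (profileAngle c f z) ^ 2) * hSC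
  · intro z hz
    have hSC := Real.sin_sq_add_cos_sq (φ z.re)
    have hch := Real.cosh_pos (profileAngle c f z)
    have hnd := h.nondegenerate z.re
    have e0 := congrFun hz 0
    have e1 := congrFun hz 1
    have e2 := congrFun hz 2
    have hD : D = 0 := by simpa [profileV] using e2
    simp [profileV, hD, hch.ne'] at e0 e1
    rw [hD] at hnd
    rcases e0 with e0 | e0
    · simp [e0] at hnd
    · rcases e1 with e1 | e1
      · simp [e1] at hnd
      · simp [e0, e1] at hSC
  · rintro ⟨u, v⟩
    have hSC := Real.sin_sq_add_cos_sq (φ u)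
    have hch := (Real.cosh_pos (profileAngle c f ⟨u, v⟩)).ne'
    have hcs := Real.cosh_sq (profileAngle c f ⟨u, v⟩)
    rw [h.normalCoord_profileMap h₁ h₂ hc, h.pd_one_profileU, h.pd_I_profileV]
    -- a polynomial identity modulo `sin² φ + cos² φ = 1` and `cosh² A = sinh² A + 1`
    simp [profileNormal, profileU, profileV, Bfun]
    field_simp
    generalize Real.sin (φ u) = S at *
    generalize Real.cos (φ u) = C at *
    generalize Real.cosh (profileAngle c f ⟨u, v⟩) = ch at *
    generalize Real.sinh (profileAngle c f ⟨u, v⟩) = sh at *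
    have hC2 : C ^ 2 = 1 - S ^ 2 := by linarith
    have hC3 : C ^ 3 = C * (1 - S ^ 2) := by rw [← hC2]; ring
    ring_nf
    simp only [hC3, hcs]
    ring

end IsProfile

/-! ### The Gauss map -/

theorem gaussMap_eq_of_normalCoord {l₁ l₂ A ψ : ℝ} {X : ℂ → E2Cover} {z : ℂ}
    (h : normalCoord l₁ l₂ X z =
      ![Real.cos ψ / Real.cosh A, Real.sin ψ / Real.cosh A, -(Real.sinh A / Real.cosh A)]) :
    gaussMap l₁ l₂ X z = ((Complex.exp (A : ℂ) * Complex.exp (Complex.I * (ψ : ℂ)) : ℂ) :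
      OnePoint ℂ) := by
  have hch := Real.cosh_pos A
  have h1 : 1 + -(Real.sinh A / Real.cosh A) = (Real.exp A * Real.cosh A)⁻¹ := by
    rw [eq_comm, inv_eq_iff_eq_inv, ← sub_eq_add_neg, one_sub_div hch.ne', Real.cosh_sub_sinh,
      Real.exp_neg]
    field_simp
  -- the normal never points to the pole of the projection, so the value is finite
  have hne : normalCoord l₁ l₂ X z 2 ≠ -1 := by
    intro h2
    rw [h] at h2
    have : (Real.exp A * Real.cosh A)⁻¹ = 0 := by rw [← h1]; simp at h2; linarith
    have : 0 < (Real.exp A * Real.cosh A)⁻¹ := by positivity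
    linarith
  simp only [gaussMap, if_neg hne]
  congr 1
  have h3 : (1 + normalCoord l₁ l₂ X z 2 : ℂ) = ((Real.exp A * Real.cosh A)⁻¹ : ℝ) := by
    rw [← h1, h]; push_cast; simp
  have hcc : (Real.cosh A : ℂ) ≠ 0 := by exact_mod_cast hch.ne'
  rw [h3, h, mul_comm Complex.I, Complex.exp_mul_I]
  simp only [Matrix.cons_val_zero, Matrix.cons_val_one]
  push_cast at hcc ⊢
  field_simp

theorem annulusMap_eq_profileMap {l₁ l₂ c θ : ℝ} {φ f : ℝ → ℝ} (hB : ∀ u, Bfun l₁ l₂ φ u ≠ 0)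
    (hf : ∀ u : ℝ, HasDerivAt f (Dconst c θ * Bfun l₁ l₂ φ u) u) :
    annulusMap l₁ l₂ c θ φ f = profileMap l₁ l₂ c (Dconst c θ) φ f
      (fun u => (c - deriv φ u) / Bfun l₁ l₂ φ u) (Gfun l₁ l₂ c θ φ) := by
  funext z
  have hx : -l₁ * l₂ * Dconst c θ * z.im + l₁ * l₂ * Gfun l₁ l₂ c θ φ z.re
      = profileHeight l₁ l₂ (Dconst c θ) (Gfun l₁ l₂ c θ φ) z := by
    rw [profileHeight]; ring
  have hBz := hB z.re
  have hR : (c ^ 2 + l₁ ^ 2 * l₂ ^ 2 * Dconst c θ ^ 2)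
    = (c ^ 2 + (l₁ * l₂ * Dconst c θ) ^ 2) := by ring
  ext i
  simp only [annulusMap, profileMap, hx, (hf z.re).deriv, hR, mixCC, mixCS, mixSS, mixSC,
    profileAngle, one_div, mul_inv]
  fin_cases i
  · simp
    field_simp
  · simp
    field_simp
  · simp

end E2Cover

theorem theorem5p1 (l₁ l₂ : ℝ) (hl₂ : 0 < l₂) (hl : l₂ ≤ l₁)
    (c θ : ℝ) (hΩ : (c, θ) ∈ E2Cover.Omega l₁)
    (φ f : ℝ → ℝ)
    (hφ0 : φ 0 = 0)
    (hφ : ∀ u : ℝ, HasDerivAt φ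
      (√(c ^ 2 + 2 * Real.cos θ * E2Cover.Bfun l₁ l₂ φ u
        - E2Cover.Dconst c θ ^ 2 * E2Cover.Bfun l₁ l₂ φ u ^ 2)) u)
    (hf0 : f 0 = 0)
    (hf : ∀ u : ℝ, HasDerivAt f (E2Cover.Dconst c θ * E2Cover.Bfun l₁ l₂ φ u) u) :
    E2Cover.IsConformalMinimalImmersion l₁ l₂ (E2Cover.annulusMap l₁ l₂ c θ φ f) ∧
    ∀ u v : ℝ,
      E2Cover.gaussMap l₁ l₂ (E2Cover.annulusMap l₁ l₂ c θ φ f) (u + v * Complex.I)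
        = ((Complex.exp ((f u + c * v : ℝ) : ℂ) * Complex.exp (Complex.I * (φ u : ℂ)) : ℂ) :
            OnePoint ℂ) := by
  have hl₁ : 0 < l₁ := hl₂.trans_le hl
  have hprof := E2Cover.isProfile_of_ode hl₂ hl hΩ hφ hf
  rw [E2Cover.annulusMap_eq_profileMap (fun u => (E2Cover.Bfun_pos hl₁ hl₂ φ u).ne') hf]
  refine ⟨hprof.isConformalMinimalImmersion hl₁.ne' hl₂.ne' hΩ.1.ne', fun u v => ?_⟩
  apply E2Cover.gaussMap_eq_of_normalCoord
  rw [hprof.normalCoord_profileMap hl₁.ne' hl₂.ne' hΩ.1.ne']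
  simp [E2Cover.profileNormal, E2Cover.profileAngle]
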